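/- Let $d\ge 1$, let $\Omega\subset\mathbb R^d$ be open and bounded, and let $u\in L^\infty(\Omega)$ and $w\in L^\infty(\Omega\times\Omega)$ be nonnegative, where $u$ has finitely many flat regions, i.e. $|\{x\in\Omega: u(x)=q\}|>0$ for only finitely many $q\in\mathbb R$. For a measurable set $A\subset\mathbb R^d$ of finite measure and $f\in L^\infty(A)$ let $f_*(s)=\inf\{q\in\mathbb R: |\{y\in A: f(y)>q\}|\le s\}$, $0<s<|A|$, be the decreasing rearrangement of $f$. For $v\in L^\infty(\Omega)$ let $$v_{*u}(s)=\frac{d}{ds}\Big(\int_{\{u>u_*(s)\}} v(y)\,dy+\int_0^{s-|\{u>u_*(s)\}|}\big(v|_{\{u=u_*(s)\}}\big)_*(\sigma)\,d\sigma\Big),\qquad 0<s<|\Omega|,$$ be the relative rearrangement of $v$ with respect to $u$. For $K:\mathbb R\to[0,\infty)$ and $h>0$ put $K_h(\xi)=K(\xi/h)$ and $$F^*_h u(x)=\frac{\int_0^{|\Omega|}K_h(u(x)-u_*(s))\,u_*(s)\,w(x,\cdot)_{*u}(s)\,ds}{\int_0^{|\Omega|}K_h(u(x)-u_*(s))\,w(x,\cdot)_{*u}(s)\,ds}$$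 (with the convention $0/0=0$), and let $F^*_{h,m}$ be the same expression with $w$ replaced by a given $w_m$. Then there exist sequences of nonnegative step functions $u_n$ and $w_m$ (measurable, with finitely many values) such that $u_n\to u$ strongly in $L^\infty(\Omega)$, $w_m\to w$ strongly in $L^\infty(\Omega\times\Omega)$, and such that the following holds for every $h>0$ and every continuous $K:\mathbb R\to[0,\infty)$ for which there is $c>0$ with $$\int_\Omega K_h(u(x)-u(y))\,w(x,y)\,dy\ \ge\ c\int_\Omega w(x,y)\,dy\qquad\text{for a.e. }x\in\Omega$$ (this is automatic if $K$ is continuous and positive, e.g. Gaussian). The functions $F^*_hu$ and $F^*_{h,m}u_n$ belong to $L^\infty(\Omega)$; the denominator of $F_h^*u(x)$ is positive for a.e. $x$ with $\int_\Omega w(x,y)\,dy>0$, and so is that of $F^*_{h,m}u_n(x)$ for all sufficiently large $n,m$ (uniformly in $x$); and, as $n,m\to\infty$, $$F^*_{h,m}u_n\to F^*_hu\quad\text{a.e. in }\Omega\text{ and strongly in }L^\infty(\Omega).$$ -/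

import Mathlib

open MeasureTheory Filter Topology
open scoped ENNReal

noncomputable section

/-- The distribution function `m_f(q) = μ {f > q}`. -/
def distributionFn {α : Type*} [MeasurableSpace α] (μ : Measure α) (f : α → ℝ) (q : ℝ) : ℝ :=
  μ.real {x | q < f x}

/-- The decreasing rearrangement `f_*` on `[0, μ(α)]` (for `μ` Lebesgue measure restricted to `Ω`,
on `[0, |Ω|]`): the essential supremum at `0`, the essential infimum at `μ(α)`, and
`inf {q | m_f(q) ≤ s}` for `s` strictly in between. It is extended by constants outside. -/
def decRearr {α : Type*} [MeasurableSpace α] (μ : Measure α) (f : α → ℝ) (s : ℝ) : ℝ :=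
  if s ≤ 0 then essSup f μ
  else if μ.real Set.univ ≤ s then essInf f μ
  else sInf {q : ℝ | distributionFn μ f q ≤ s}

/-- The function
`s ↦ ∫_{u > u_*(s)} v + ∫_0^{s - |u > u_*(s)|} (v|_{u = u_*(s)})_*(σ) dσ`,
whose derivative is the relative rearrangement. -/
def relRearrPrimitive {α : Type*} [MeasurableSpace α] (μ : Measure α) (u v : α → ℝ) (s : ℝ) : ℝ :=
  (∫ y in {y | decRearr μ u s < u y}, v y ∂μ) +
    ∫ σ in (0 : ℝ)..(s - μ.real {y | decRearr μ u s < u y}),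
      decRearr (μ.restrict {y | u y = decRearr μ u s}) v σ

/-- The relative rearrangement `v_{*u}` of `v` with respect to `u`, on `(0, μ(α))`. For bounded `v`
the primitive is Lipschitz there, so its pointwise derivative exists almost everywhere and is
its weak derivative. -/
def relRearr {α : Type*} [MeasurableSpace α] (μ : Measure α) (u v : α → ℝ) (s : ℝ) : ℝ :=
  deriv (relRearrPrimitive μ u v) s

/-- The normalization factor `C(x) = ∫ K((u(x) - u(y)) / h) w(x, y) dy` of the nonlocal filter. -/
def filterNorm {α : Type*} [MeasurableSpace α] (μ : Measure α) (K : ℝ → ℝ) (h : ℝ)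
    (u : α → ℝ) (w : α → α → ℝ) (x : α) : ℝ :=
  ∫ y, K ((u x - u y) / h) * w x y ∂μ

/-- The denominator
`∫_0^{|Ω|} K((u(x) - u_*(s)) / h) w(x, ·)_{*u}(s) ds` of the rearranged filter. -/
def rearrFilterDen {α : Type*} [MeasurableSpace α] (μ : Measure α) (K : ℝ → ℝ) (h : ℝ)
    (u : α → ℝ) (w : α → α → ℝ) (x : α) : ℝ :=
  ∫ s in (0 : ℝ)..μ.real Set.univ, K ((u x - decRearr μ u s) / h) * relRearr μ u (w x) s

/-- The numerator
`∫_0^{|Ω|} K((u(x) - u_*(s)) / h) u_*(s) w(x, ·)_{*u}(s) ds` of the rearranged filter. -/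
def rearrFilterNum {α : Type*} [MeasurableSpace α] (μ : Measure α) (K : ℝ → ℝ) (h : ℝ)
    (u : α → ℝ) (w : α → α → ℝ) (x : α) : ℝ :=
  ∫ s in (0 : ℝ)..μ.real Set.univ,
    K ((u x - decRearr μ u s) / h) * decRearr μ u s * relRearr μ u (w x) s

/-- The rearranged nonlocal filter `F_h^* u(x)` with weight `w`. The filter `F_{h,m}^*` is the
same expression with the weight `w_m` in place of `w`. -/
def rearrFilter {α : Type*} [MeasurableSpace α] (μ : Measure α) (K : ℝ → ℝ) (h : ℝ)
    (u : α → ℝ) (w : α → α → ℝ) (x : α) : ℝ :=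
  rearrFilterNum μ K h u w x / rearrFilterDen μ K h u w x

/-- `u` has finitely many flat regions: only finitely many of its level sets have positive
measure. -/
def FinitelyManyFlatRegions {α : Type*} [MeasurableSpace α] (μ : Measure α) (u : α → ℝ) : Prop :=
  {q : ℝ | μ {x | u x = q} ≠ 0}.Finite

end

/-!
The rearranged filter is an ordinary nonlocal filter in disguise. For bounded `u, v ≥ 0`, the
primitive whose derivative is the relative rearrangement `v_{*u}` is nondecreasing and Lipschitz
(`relRearrPrimitive_sub_mem_Icc`), and its value at `s = μ {u > q}` is `∫_{u > q} v`
(`relRearrPrimitive_distributionFn`). Hence the measures `v_{*u} ds` and `v dμ` have the same image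
under `u_*` and `u` (`map_decRearr_relRearr`), so that `∫ g(u_*) v_{*u} ds = ∫ g(u) v dμ`
(`integral_mul_relRearr`), and `F^*_h u(x)` is the quotient of `∫ K_h(u(x) - u(y)) u(y) w(x, y) dy`
by `∫ K_h(u(x) - u(y)) w(x, y) dy` (`rearrFilter_eq`).

Such a quotient is bounded by `sup u`, but for convergence uniform in `x` the numerators and
denominators have to converge with errors that are small relative to `W(x) = ∫ w(x, y) dy`, which
need not be bounded away from `0`. Mere uniform convergence of `w_m` does not give this. Therefore
`w_m` is built from `w` by rounding down to multiples of `1 / (m + 1)` and adding `1 / (m + 1)` on a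
set `E` for which `∫_A w_m(x, y) dy = ∫_A w(x, y) dy` holds exactly, for all `x` and all level sets
`A` of the step function `u_m` (`exists_simpleFunc_weight`); the slices of `E` are intersections of
level sets with balls, whose radii depend measurably on `x` (`exists_monotone_radius`). Then `w_m`
and `w` have the same mass `W(x)` and integrate functions of `u_m` in the same way. Replacing `u_n`
by `u_m`, then `w_m` by `w`, and finally `u_m` by `u` costs `o(1) W(x)` by uniform continuity of the
kernel (`eventually_abs_nonlocalIntegral_sub_le`). As the denominator is at least `c W(x)`, the
quotients converge uniformly (`abs_div_sub_div_le`); where `W(x) = 0`, they coincide.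
-/

/-! ### The decreasing rearrangement -/

section Rearrangement

variable {α : Type*} [MeasurableSpace α] {μ : Measure α} {f : α → ℝ} {C : ℝ}

theorem distributionFn_nonneg (q : ℝ) : 0 ≤ distributionFn μ f q := measureReal_nonneg

theorem distributionFn_eq_zero (hb : ∀ x, f x ∈ Set.Icc 0 C) {q : ℝ} (hq : C ≤ q) :
    distributionFn μ f q = 0 := by
  have : {x | q < f x} = ∅ := by
    ext x; simpa using (hb x).2.trans hq
  simp [distributionFn, this]

theorem distributionFn_eq_univ (hb : ∀ x, f x ∈ Set.Icc 0 C) {q : ℝ} (hq : q < 0) :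
    distributionFn μ f q = μ.real Set.univ := by
  have : {x | q < f x} = Set.univ := by
    ext x; simpa using hq.trans_le (hb x).1
  simp [distributionFn, this]

theorem isBoundedUnder_le_of_mem_Icc (hb : ∀ x, f x ∈ Set.Icc 0 C) :
    IsBoundedUnder (· ≤ ·) (ae μ) f := isBoundedUnder_of ⟨C, fun x => (hb x).2⟩

theorem isBoundedUnder_ge_of_mem_Icc (hb : ∀ x, f x ∈ Set.Icc 0 C) :
    IsBoundedUnder (· ≥ ·) (ae μ) f := isBoundedUnder_of ⟨0, fun x => (hb x).1⟩

theorem decRearr_univ (hM : 0 < μ.real Set.univ) :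
    decRearr μ f (μ.real Set.univ) = essInf f μ := by
  rw [decRearr, if_neg hM.not_ge, if_pos le_rfl]

theorem ae_decRearr_univ_le (hb : ∀ x, f x ∈ Set.Icc 0 C) (hM : 0 < μ.real Set.univ) :
    ∀ᵐ x ∂μ, decRearr μ f (μ.real Set.univ) ≤ f x := by
  rw [decRearr_univ hM]
  exact ae_essInf_le (isBoundedUnder_ge_of_mem_Icc hb)

variable [IsFiniteMeasure μ]

theorem distributionFn_le (q : ℝ) : distributionFn μ f q ≤ μ.real Set.univ :=
  measureReal_mono (Set.subset_univ _)

theorem distributionFn_antitone : Antitone (distributionFn μ f) := fun _ _ h =>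
  measureReal_mono fun _ hx => lt_of_le_of_lt h hx

/-- Right continuity of the distribution function. -/
theorem exists_gt_lt_distributionFn {s q : ℝ} (h : s < distributionFn μ f q) :
    ∃ q' > q, s < distributionFn μ f q' := by
  have hU : {x | q < f x} = ⋃ n : ℕ, {x | q + 1 / ((n : ℝ) + 1) < f x} := by
    ext x
    simp only [Set.mem_ofPred_eq, Set.mem_iUnion]
    constructor
    · intro hx
      obtain ⟨n, hn⟩ := exists_nat_one_div_lt (sub_pos.2 hx)
      exact ⟨n, by linarith⟩
    · rintro ⟨n, hn⟩
      have : 0 < 1 / ((n : ℝ) + 1) := by positivity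
      linarith
  have hmono : Monotone fun n : ℕ => {x | q + 1 / ((n : ℝ) + 1) < f x} := by
    intro m n hmn x hx
    have : 1 / ((n : ℝ) + 1) ≤ 1 / ((m : ℝ) + 1) := Nat.one_div_le_one_div hmn
    simp only [Set.mem_ofPred_eq] at hx ⊢
    linarith
  have ht := tendsto_measure_iUnion_atTop (μ := μ) hmono
  rw [← hU] at ht
  have ht' := (ENNReal.tendsto_toReal (measure_ne_top μ _)).comp ht
  obtain ⟨n, hn⟩ := (ht'.eventually (lt_mem_nhds h)).exists
  exact ⟨_, by have : 0 < 1 / ((n : ℝ) + 1) := by positivity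
               linarith, hn⟩

/-- The left limits of the distribution function are the measures of the sets `{f ≥ q}`. -/
theorem exists_lt_distributionFn_lt (hf : Measurable f) {s q : ℝ} (h : μ.real {x | q ≤ f x} < s) :
    ∃ q' < q, distributionFn μ f q' < s := by
  have hU : {x | q ≤ f x} = ⋂ n : ℕ, {x | q - 1 / ((n : ℝ) + 1) < f x} := by
    ext x
    simp only [Set.mem_ofPred_eq, Set.mem_iInter]
    constructor
    · intro hx n
      have : 0 < 1 / ((n : ℝ) + 1) := by positivity
      linarith
    · intro hx
      by_contra! hlt
      obtain ⟨n, hn⟩ := exists_nat_one_div_lt (sub_pos.2 hlt)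
      linarith [hx n]
  have hanti : Antitone fun n : ℕ => {x | q - 1 / ((n : ℝ) + 1) < f x} := by
    intro m n hmn x hx
    have : 1 / ((n : ℝ) + 1) ≤ 1 / ((m : ℝ) + 1) := Nat.one_div_le_one_div hmn
    simp only [Set.mem_ofPred_eq] at hx ⊢
    linarith
  have ht := tendsto_measure_iInter_atTop (μ := μ)
    (fun n => (measurableSet_lt measurable_const hf).nullMeasurableSet) hanti
    ⟨0, measure_ne_top μ _⟩
  rw [← hU] at ht
  have ht' := (ENNReal.tendsto_toReal (measure_ne_top μ _)).comp ht
  obtain ⟨n, hn⟩ := (ht'.eventually (gt_mem_nhds h)).exists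
  exact ⟨_, by have : 0 < 1 / ((n : ℝ) + 1) := by positivity
               linarith, hn⟩

/-- The Galois-type relation between a rearrangement and the distribution function, from which the
other properties of the rearrangement are read off. It holds at `s = 0`, where the rearrangement is
the essential supremum, but not at `s = μ(α)`. -/
theorem lt_decRearr_iff (hb : ∀ x, f x ∈ Set.Icc 0 C) {s q : ℝ}
    (hs0 : 0 ≤ s) (hsM : s < μ.real Set.univ) :
    q < decRearr μ f s ↔ s < distributionFn μ f q := by
  have : NeZero μ := ⟨by rintro rfl; simp at hsM; linarith⟩
  rcases hs0.eq_or_lt with rfl | hs0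
  · rw [decRearr, if_pos le_rfl, ← not_le, ← not_le, not_iff_not]
    constructor
    · intro h
      refine le_of_eq ?_
      rw [distributionFn, measureReal_eq_zero_iff]
      have := ae_le_essSup (isBoundedUnder_le_of_mem_Icc (μ := μ) hb)
      rw [ae_iff] at this
      refine measure_mono_null (fun x hx => ?_) this
      exact not_le.2 (lt_of_le_of_lt h hx)
    · intro h
      have h0 : distributionFn μ f q = 0 := le_antisymm h (distributionFn_nonneg q)
      rw [distributionFn, measureReal_eq_zero_iff] at h0
      refine limsSup_le_of_le ?_ ?_
      · exact (isBoundedUnder_ge_of_mem_Icc (μ := μ) hb).isCobounded_flip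
      · change ∀ᵐ x ∂μ, f x ≤ q
        rw [ae_iff]; simpa using h0
  · rw [decRearr, if_neg hs0.not_ge, if_neg hsM.not_ge]
    have hbdd : BddBelow {q : ℝ | distributionFn μ f q ≤ s} := by
      refine ⟨0, fun q hq => ?_⟩
      by_contra! h
      have := distributionFn_eq_univ (μ := μ) hb h
      exact absurd hq (by simpa [this] using hsM)
    have hne : {q : ℝ | distributionFn μ f q ≤ s}.Nonempty :=
      ⟨C, by simpa [distributionFn_eq_zero (μ := μ) hb le_rfl] using hs0.le⟩
    constructor
    · intro h
      exact not_le.1 (notMem_of_lt_csInf (s := {q : ℝ | distributionFn μ f q ≤ s}) h hbdd)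
    · intro h
      obtain ⟨q', hq', h'⟩ := exists_gt_lt_distributionFn h
      refine lt_of_lt_of_le hq' (le_csInf hne fun t ht => ?_)
      by_contra! htq
      exact absurd (lt_of_lt_of_le h' (distributionFn_antitone htq.le)) (not_lt.2 ht)

/-- The set `{f > f_*(s)}` has measure at most `s`, also at the endpoints `s = 0` and `s = μ(α)`. -/
theorem distributionFn_decRearr_le (hb : ∀ x, f x ∈ Set.Icc 0 C) {s : ℝ}
    (hs : s ∈ Set.Icc 0 (μ.real Set.univ)) : distributionFn μ f (decRearr μ f s) ≤ s := by
  rcases hs.2.eq_or_lt with rfl | h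
  · exact distributionFn_le _
  · exact not_lt.1 fun h' => lt_irrefl _ ((lt_decRearr_iff hb hs.1 h).2 h')

/-- The set `{f ≥ f_*(s)}` has measure at least `s`, also at the endpoints `s = 0` and `s = μ(α)`. -/
theorem le_measureReal_decRearr_le (hf : Measurable f) (hb : ∀ x, f x ∈ Set.Icc 0 C) {s : ℝ}
    (hs : s ∈ Set.Icc 0 (μ.real Set.univ)) : s ≤ μ.real {x | decRearr μ f s ≤ f x} := by
  rcases hs.2.eq_or_lt with rfl | h
  · rcases hs.1.eq_or_lt with h0 | h0
    · rw [← h0]; exact measureReal_nonneg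
    · refine le_of_eq (measureReal_congr ?_).symm
      exact eventuallyEq_univ.2 (ae_decRearr_univ_le hb h0)
  · by_contra! hlt
    obtain ⟨q', hq', h'⟩ := exists_lt_distributionFn_lt hf hlt
    exact absurd ((lt_decRearr_iff hb hs.1 h).1 hq') h'.not_gt

theorem decRearr_antitoneOn (hb : ∀ x, f x ∈ Set.Icc 0 C) :
    AntitoneOn (decRearr μ f) (Set.Icc 0 (μ.real Set.univ)) := by
  intro s hs t ht hst
  rcases hst.eq_or_lt with rfl | hlt
  · exact le_rfl
  have hsM := hlt.trans_le ht.2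
  refine le_of_forall_lt fun q hq => (lt_decRearr_iff hb hs.1 hsM).2 ?_
  rcases ht.2.eq_or_lt with rfl | htM
  · refine hlt.trans_le (measureReal_congr ?_).ge
    exact eventuallyEq_univ.2
      ((ae_decRearr_univ_le hb (hs.1.trans_lt hlt)).mono fun x hx => hq.trans_le hx)
  · exact hlt.trans ((lt_decRearr_iff hb ht.1 htM).1 hq)

theorem decRearr_mem_Icc (hb : ∀ x, f x ∈ Set.Icc 0 C) {s : ℝ}
    (hs : s ∈ Set.Ioo 0 (μ.real Set.univ)) : decRearr μ f s ∈ Set.Icc 0 C := by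
  constructor
  · refine le_of_forall_lt fun q hq => (lt_decRearr_iff hb hs.1.le hs.2).2 ?_
    rw [distributionFn_eq_univ hb hq]; exact hs.2
  · refine not_lt.1 fun h => ?_
    have := (lt_decRearr_iff hb hs.1.le hs.2).1 h
    rw [distributionFn_eq_zero hb le_rfl] at this
    exact lt_asymm hs.1 this

theorem aemeasurable_decRearr (hb : ∀ x, f x ∈ Set.Icc 0 C) :
    AEMeasurable (decRearr μ f) (volume.restrict (Set.Ioo 0 (μ.real Set.univ))) :=
  aemeasurable_restrict_of_antitoneOn measurableSet_Ioo
    ((decRearr_antitoneOn hb).mono Set.Ioo_subset_Icc_self)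

theorem Ioo_inter_lt_decRearr (hb : ∀ x, f x ∈ Set.Icc 0 C) (q : ℝ) :
    {s | q < decRearr μ f s} ∩ Set.Ioo 0 (μ.real Set.univ) =
      Set.Ioo 0 (distributionFn μ f q) := by
  ext s
  constructor
  · rintro ⟨h, hs⟩
    exact ⟨hs.1, (lt_decRearr_iff hb hs.1.le hs.2).1 h⟩
  · rintro ⟨h0, h⟩
    have hM := h.trans_le (distributionFn_le q)
    exact ⟨(lt_decRearr_iff hb h0.le hM).2 h, h0, hM⟩

/-- Two measures on the real line, one of them finite, agree as soon as they have the same total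
mass and agree on the half-lines `(q, ∞)`. -/
theorem ext_of_Ioi_of_univ {ν₁ ν₂ : Measure ℝ} [IsFiniteMeasure ν₁]
    (hu : ν₁ Set.univ = ν₂ Set.univ) (h : ∀ q, ν₁ (Set.Ioi q) = ν₂ (Set.Ioi q)) : ν₁ = ν₂ := by
  refine ext_of_generate_finite (Set.range Set.Ioi) ?_ isPiSystem_Ioi ?_ hu
  · rw [← borel_eq_generateFrom_Ioi]; exact BorelSpace.measurable_eq
  · rintro _ ⟨q, rfl⟩; exact h q

/-- A function and its decreasing rearrangement are equimeasurable. -/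
theorem map_decRearr (hf : Measurable f) (hb : ∀ x, f x ∈ Set.Icc 0 C) :
    (volume.restrict (Set.Ioo 0 (μ.real Set.univ))).map (decRearr μ f) = μ.map f := by
  refine ext_of_Ioi_of_univ ?_ fun q => ?_
  · rw [Measure.map_apply_of_aemeasurable (aemeasurable_decRearr hb) MeasurableSet.univ,
      Measure.map_apply hf MeasurableSet.univ]
    simp
  · rw [Measure.map_apply_of_aemeasurable (aemeasurable_decRearr hb) measurableSet_Ioi,
      Measure.map_apply hf measurableSet_Ioi, Measure.restrict_apply' measurableSet_Ioo]
    change volume ({s | q < decRearr μ f s} ∩ _) = _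
    rw [Ioo_inter_lt_decRearr hb, Real.volume_Ioo, sub_zero, distributionFn,
      ofReal_measureReal]
    rfl

theorem integral_decRearr (hf : Measurable f) (hb : ∀ x, f x ∈ Set.Icc 0 C) :
    ∫ s in (0 : ℝ)..μ.real Set.univ, decRearr μ f s = ∫ x, f x ∂μ := by
  rw [intervalIntegral.integral_of_le measureReal_nonneg, integral_Ioc_eq_integral_Ioo]
  have h1 := integral_map (aemeasurable_decRearr (μ := μ) hb)
    (f := fun q : ℝ => q) aestronglyMeasurable_id
  have h2 := integral_map (μ := μ) hf.aemeasurable (f := fun q : ℝ => q) aestronglyMeasurable_id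
  rw [map_decRearr hf hb] at h1
  exact h1.symm.trans h2

theorem intervalIntegrable_decRearr (hb : ∀ x, f x ∈ Set.Icc 0 C) {s t : ℝ}
    (hs : s ∈ Set.Icc 0 (μ.real Set.univ)) (ht : t ∈ Set.Icc 0 (μ.real Set.univ)) :
    IntervalIntegrable (decRearr μ f) volume s t :=
  ((decRearr_antitoneOn hb).mono (Set.ordConnected_Icc.uIcc_subset hs ht)).intervalIntegrable

/-- The partial integrals of a rearrangement are nondecreasing and Lipschitz. -/
theorem integral_decRearr_mem_Icc (hb : ∀ x, f x ∈ Set.Icc 0 C) {s t : ℝ}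
    (hs : 0 ≤ s) (hst : s ≤ t) (ht : t ≤ μ.real Set.univ) :
    ∫ σ in s..t, decRearr μ f σ ∈ Set.Icc 0 (C * (t - s)) := by
  have hi := intervalIntegrable_decRearr (μ := μ) hb (s := s) (t := t)
    ⟨hs, hst.trans ht⟩ ⟨hs.trans hst, ht⟩
  have hm : ∀ σ ∈ Set.Ioo s t, decRearr μ f σ ∈ Set.Icc 0 C := fun σ hσ =>
    decRearr_mem_Icc hb ⟨hs.trans_lt hσ.1, hσ.2.trans_le ht⟩
  constructor
  · rw [intervalIntegral.integral_of_le hst, integral_Ioc_eq_integral_Ioo]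
    exact setIntegral_nonneg measurableSet_Ioo fun σ hσ => (hm σ hσ).1
  · have := intervalIntegral.integral_mono_on_of_le_Ioo hst hi
      (intervalIntegrable_const (c := C)) fun σ hσ => (hm σ hσ).2
    simpa [mul_comm] using this

end Rearrangement

/-! ### The relative rearrangement -/

section RelativeRearrangement

variable {α : Type*} [MeasurableSpace α] {μ : Measure α} [IsFiniteMeasure μ] {u v : α → ℝ}
  {U C : ℝ}

theorem integrable_of_mem_Icc {f : α → ℝ} (hf : Measurable f) (hb : ∀ x, f x ∈ Set.Icc 0 C) :
    Integrable f μ :=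
  Integrable.of_mem_Icc 0 C hf.aemeasurable (ae_of_all _ hb)

theorem setIntegral_mem_Icc (hv : Measurable v) (hvb : ∀ x, v x ∈ Set.Icc 0 C)
    {A : Set α} (hA : MeasurableSet A) :
    ∫ x in A, v x ∂μ ∈ Set.Icc 0 (C * μ.real A) := by
  constructor
  · exact setIntegral_nonneg hA fun x _ => (hvb x).1
  · have := setIntegral_mono (μ := μ) (s := A) (integrable_of_mem_Icc hv hvb).integrableOn
      (integrableOn_const (measure_ne_top μ A)) fun x => (hvb x).2
    simpa [mul_comm] using this

/-- The primitive of the relative rearrangement of `v ∈ [0, C]` is nondecreasing and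
`C`-Lipschitz. -/
theorem relRearrPrimitive_sub_mem_Icc (hu : Measurable u) (hub : ∀ x, u x ∈ Set.Icc 0 U)
    (hv : Measurable v) (hvb : ∀ x, v x ∈ Set.Icc 0 C) {s t : ℝ}
    (hs : s ∈ Set.Icc 0 (μ.real Set.univ)) (ht : t ∈ Set.Icc 0 (μ.real Set.univ)) (hst : s ≤ t) :
    relRearrPrimitive μ u v t - relRearrPrimitive μ u v s ∈ Set.Icc 0 (C * (t - s)) := by
  have hsm := distributionFn_decRearr_le hub hs
  have htm := distributionFn_decRearr_le hub ht
  have hsn := le_measureReal_decRearr_le hu hub hs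
  have htn := le_measureReal_decRearr_le hu hub ht
  have hanti := decRearr_antitoneOn hub hs ht hst
  have hn : ∀ q, μ.real {x | q ≤ u x} =
      distributionFn μ u q + (μ.restrict {y | u y = q}).real Set.univ := by
    intro q
    have hd : Disjoint {x | q < u x} {x | u x = q} :=
      Set.disjoint_left.2 fun x (hx : q < u x) (hx' : u x = q) => hx.ne' hx'
    rw [measureReal_restrict_apply_univ, distributionFn,
      ← measureReal_union hd (hu (measurableSet_singleton q))]
    congr 1; ext x
    simp only [Set.mem_ofPred_eq, Set.mem_union]
    rw [le_iff_lt_or_eq, eq_comm (a := q)]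
  have hint : ∀ {q r r' : ℝ}, 0 ≤ r → r ≤ r' → r' ≤ (μ.restrict {y | u y = q}).real Set.univ →
      (∫ σ in (0 : ℝ)..r', decRearr (μ.restrict {y | u y = q}) v σ) -
        ∫ σ in (0 : ℝ)..r, decRearr (μ.restrict {y | u y = q}) v σ ∈ Set.Icc 0 (C * (r' - r)) := by
    intro q r r' h0 h1 h2
    have h00 : (0 : ℝ) ∈ Set.Icc 0 ((μ.restrict {y | u y = q}).real Set.univ) :=
      ⟨le_rfl, measureReal_nonneg⟩
    rw [intervalIntegral.integral_interval_sub_left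
      (intervalIntegrable_decRearr hvb h00 ⟨h0.trans h1, h2⟩)
      (intervalIntegrable_decRearr hvb h00 ⟨h0, h1.trans h2⟩)]
    exact integral_decRearr_mem_Icc hvb h0 h1 h2
  rw [hn] at hsn htn
  unfold relRearrPrimitive
  change _ + (∫ σ in (0 : ℝ)..(t - distributionFn μ u (decRearr μ u t)), _) -
    (_ + ∫ σ in (0 : ℝ)..(s - distributionFn μ u (decRearr μ u s)), _) ∈ _
  generalize decRearr μ u s = q at *
  generalize decRearr μ u t = q' at *
  rcases hanti.eq_or_lt with rfl | hlt
  · rw [add_sub_add_left_eq_sub]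
    have := hint (q := q') (r := s - distributionFn μ u q') (r' := t - distributionFn μ u q')
      (by linarith) (by linarith) (by linarith)
    simpa using this
  · -- `{u > q'} = {q' < u < q} ∪ {u = q} ∪ {u > q}`
    have hMid : MeasurableSet {y | q' < u y ∧ u y < q} :=
      (measurableSet_lt measurable_const hu).inter (measurableSet_lt hu measurable_const)
    have hEq : MeasurableSet {y | u y = q} := hu (measurableSet_singleton q)
    have hTop : MeasurableSet {y | q < u y} := measurableSet_lt measurable_const hu
    have hsplit : {y | q' < u y} = {y | q' < u y ∧ u y < q} ∪ ({y | u y = q} ∪ {y | q < u y}) := by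
      ext y
      simp only [Set.mem_ofPred_eq, Set.mem_union]
      constructor
      · intro h
        rcases lt_trichotomy (u y) q with h' | h' | h'
        exacts [Or.inl ⟨h, h'⟩, Or.inr (Or.inl h'), Or.inr (Or.inr h')]
      · rintro (h | h | h)
        exacts [h.1, h ▸ hlt, hlt.trans h]
    have hd1 : Disjoint {y | u y = q} {y | q < u y} :=
      Set.disjoint_left.2 fun y (hy : u y = q) (hy' : q < u y) => hy'.ne' hy
    have hd2 : Disjoint {y | q' < u y ∧ u y < q} ({y | u y = q} ∪ {y | q < u y}) :=
      Set.disjoint_left.2 fun y hy hy' => hy'.elim (fun h => hy.2.ne h) (fun h => hy.2.not_gt h)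
    have hvi : ∀ A, IntegrableOn v A μ := fun A => (integrable_of_mem_Icc hv hvb).integrableOn
    have hI : ∫ y in {y | q' < u y}, v y ∂μ = ∫ y in {y | q' < u y ∧ u y < q}, v y ∂μ +
        (∫ y in {y | u y = q}, v y ∂μ + ∫ y in {y | q < u y}, v y ∂μ) := by
      rw [hsplit, setIntegral_union hd2 (hEq.union hTop) (hvi _) (hvi _),
        setIntegral_union hd1 hTop (hvi _) (hvi _)]
    have hm : distributionFn μ u q' = μ.real {y | q' < u y ∧ u y < q} +
        ((μ.restrict {y | u y = q}).real Set.univ + distributionFn μ u q) := by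
      rw [measureReal_restrict_apply_univ, distributionFn, distributionFn, hsplit,
        measureReal_union hd2 (hEq.union hTop), measureReal_union hd1 hTop]
    have h1 := setIntegral_mem_Icc (μ := μ) hv hvb hMid
    have h2 := hint (q := q) (r := s - distributionFn μ u q) (by linarith) (by linarith) le_rfl
    rw [integral_decRearr hv hvb] at h2
    have h3 := hint (q := q') (r := 0) (r' := t - distributionFn μ u q') le_rfl
      (by linarith) (by linarith)
    rw [intervalIntegral.integral_same, sub_zero, sub_zero] at h3
    rw [hI]
    constructor
    · linarith [h1.1, h2.1, h3.1]
    · have : C * (t - s) = C * μ.real {y | q' < u y ∧ u y < q} +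
          C * ((μ.restrict {y | u y = q}).real Set.univ - (s - distributionFn μ u q)) +
          C * (t - distributionFn μ u q') := by rw [hm]; ring
      linarith [h1.2, h2.2, h3.2]

/-- At the points `μ {u > q}` the primitive is an integral over a superlevel set of `u`. -/
theorem relRearrPrimitive_distributionFn (hu : Measurable u) (hub : ∀ x, u x ∈ Set.Icc 0 U)
    (hv : Measurable v) (hvb : ∀ x, v x ∈ Set.Icc 0 C) (q : ℝ) :
    relRearrPrimitive μ u v (distributionFn μ u q) = ∫ y in {y | q < u y}, v y ∂μ := by
  have hs : distributionFn μ u q ∈ Set.Icc 0 (μ.real Set.univ) :=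
    ⟨distributionFn_nonneg q, distributionFn_le q⟩
  have hm := distributionFn_decRearr_le hub hs
  have hn := le_measureReal_decRearr_le hu hub hs
  unfold relRearrPrimitive
  change _ + (∫ σ in (0 : ℝ)..(_ - distributionFn μ u (decRearr μ u (distributionFn μ u q))), _) = _
  generalize decRearr μ u (distributionFn μ u q) = q' at *
  have hEq : MeasurableSet {y | u y = q'} := hu (measurableSet_singleton q')
  have hTop : ∀ q, MeasurableSet {y | q < u y} := fun q => measurableSet_lt measurable_const hu
  -- `q'` is the rearrangement at `μ {u > q}`. If `q' ≤ q`, the set `{q' < u ≤ q}` is null;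
  -- otherwise `{q < u < q'}` is null and the second term runs over the whole level set `{u = q'}`.
  rcases le_or_gt q' q with h | h
  · have he : distributionFn μ u q = distributionFn μ u q' :=
      le_antisymm (distributionFn_antitone h) hm
    rw [he, sub_self, intervalIntegral.integral_same, add_zero]
    refine setIntegral_congr_set ?_
    refine (ae_eq_of_subset_of_measure_ge (fun y (hy : q < u y) => h.trans_lt hy) ?_
      (hTop q).nullMeasurableSet (measure_ne_top _ _)).symm
    exact ((measureReal_eq_measureReal_iff).1 he).ge
  · have hd : Disjoint {y | q' < u y} {y | u y = q'} :=
      Set.disjoint_left.2 fun y (hy : q' < u y) (hy' : u y = q') => hy.ne' hy'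
    have hU : {y | q' ≤ u y} = {y | q' < u y} ∪ {y | u y = q'} := by
      ext y
      simp only [Set.mem_ofPred_eq, Set.mem_union]
      rw [le_iff_lt_or_eq, eq_comm (a := q')]
    have hsub : {y | q' ≤ u y} ⊆ {y | q < u y} := fun y (hy : q' ≤ u y) => h.trans_le hy
    have he : {y | q' ≤ u y} =ᵐ[μ] {y | q < u y} :=
      ae_eq_of_subset_of_measure_ge hsub
        ((ENNReal.toReal_le_toReal (measure_ne_top _ _) (measure_ne_top _ _)).1 hn)
        (measurableSet_le measurable_const hu).nullMeasurableSet (measure_ne_top _ _)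
    have hr : distributionFn μ u q - distributionFn μ u q' =
        (μ.restrict {y | u y = q'}).real Set.univ := by
      have : distributionFn μ u q = μ.real {y | q' ≤ u y} := (measureReal_congr he).symm
      rw [this, hU, measureReal_union hd hEq, measureReal_restrict_apply_univ, distributionFn]
      ring
    rw [hr, integral_decRearr hv hvb, ← setIntegral_union hd hEq
      (integrable_of_mem_Icc hv hvb).integrableOn (integrable_of_mem_Icc hv hvb).integrableOn, ← hU]
    exact setIntegral_congr_set he

theorem absolutelyContinuous_relRearrPrimitive (hu : Measurable u)
    (hub : ∀ x, u x ∈ Set.Icc 0 U) (hv : Measurable v) (hvb : ∀ x, v x ∈ Set.Icc 0 C) {t : ℝ}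
    (ht : t ∈ Set.Icc 0 (μ.real Set.univ)) :
    AbsolutelyContinuousOnInterval (relRearrPrimitive μ u v) 0 t := by
  refine LipschitzOnWith.absolutelyContinuousOnInterval (K := C.toNNReal) ?_
  rw [Set.uIcc_of_le ht.1]
  have key : ∀ x ∈ Set.Icc 0 t, ∀ y ∈ Set.Icc 0 t, x ≤ y →
      |relRearrPrimitive μ u v x - relRearrPrimitive μ u v y| ≤ C.toNNReal * |x - y| := by
    intro x hx y hy hxy
    have h := relRearrPrimitive_sub_mem_Icc hu hub hv hvb ⟨hx.1, hx.2.trans ht.2⟩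
      ⟨hy.1, hy.2.trans ht.2⟩ hxy
    rw [abs_sub_comm, abs_of_nonneg h.1, abs_sub_comm, abs_of_nonneg (sub_nonneg.2 hxy)]
    exact h.2.trans (mul_le_mul_of_nonneg_right (Real.le_coe_toNNReal C) (sub_nonneg.2 hxy))
  refine LipschitzOnWith.of_dist_le_mul fun x hx y hy => ?_
  rw [Real.dist_eq, Real.dist_eq]
  rcases le_total x y with h | h
  · exact key x hx y hy h
  · rw [abs_sub_comm, abs_sub_comm x]
    exact key y hy x hx h

theorem relRearr_nonneg (hu : Measurable u) (hub : ∀ x, u x ∈ Set.Icc 0 U)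
    (hv : Measurable v) (hvb : ∀ x, v x ∈ Set.Icc 0 C) {s : ℝ}
    (hs : s ∈ Set.Ioo 0 (μ.real Set.univ)) : 0 ≤ relRearr μ u v s := by
  have hmono : MonotoneOn (relRearrPrimitive μ u v) (Set.Ioo 0 (μ.real Set.univ)) :=
    fun x hx y hy hxy => sub_nonneg.1 (relRearrPrimitive_sub_mem_Icc hu hub hv hvb
      (Set.Ioo_subset_Icc_self hx) (Set.Ioo_subset_Icc_self hy) hxy).1
  rw [relRearr, ← derivWithin_of_isOpen isOpen_Ioo hs]
  exact hmono.derivWithin_nonneg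

theorem relRearrPrimitive_zero (hu : Measurable u) (hub : ∀ x, u x ∈ Set.Icc 0 U)
    (hv : Measurable v) (hvb : ∀ x, v x ∈ Set.Icc 0 C) : relRearrPrimitive μ u v 0 = 0 := by
  have h := relRearrPrimitive_distributionFn (μ := μ) hu hub hv hvb U
  have he : {y | U < u y} = ∅ := by ext y; simpa using (hub y).2
  rwa [distributionFn_eq_zero hub le_rfl, he, setIntegral_empty] at h

/-- The integral of the derivative of the primitive recovers the primitive, because the latter is
absolutely continuous. -/
theorem lintegral_relRearr (hu : Measurable u) (hub : ∀ x, u x ∈ Set.Icc 0 U)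
    (hv : Measurable v) (hvb : ∀ x, v x ∈ Set.Icc 0 C) (q : ℝ) :
    ∫⁻ s in Set.Ioo 0 (distributionFn μ u q), ENNReal.ofReal (relRearr μ u v s) =
      ∫⁻ y in {y | q < u y}, ENNReal.ofReal (v y) ∂μ := by
  have hs : distributionFn μ u q ∈ Set.Icc 0 (μ.real Set.univ) :=
    ⟨distributionFn_nonneg q, distributionFn_le q⟩
  have hac := absolutelyContinuous_relRearrPrimitive hu hub hv hvb hs
  have hi := hac.intervalIntegrable_deriv
  rw [intervalIntegrable_iff_integrableOn_Ioo_of_le hs.1] at hi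
  have hftc := hac.integral_deriv_eq_sub
  rw [relRearrPrimitive_zero hu hub hv hvb, sub_zero, relRearrPrimitive_distributionFn hu hub hv hvb,
    intervalIntegral.integral_of_le hs.1, integral_Ioc_eq_integral_Ioo] at hftc
  change ∫⁻ s in _, ENNReal.ofReal (deriv (relRearrPrimitive μ u v) s) = _
  rw [← ofReal_integral_eq_lintegral_ofReal hi, ← ofReal_integral_eq_lintegral_ofReal
    (integrable_of_mem_Icc hv hvb).integrableOn (ae_of_all _ fun x => (hvb x).1), ← hftc]
  · refine (ae_restrict_iff' measurableSet_Ioo).2 (ae_of_all _ fun s hs' => ?_)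
    exact relRearr_nonneg hu hub hv hvb ⟨hs'.1, hs'.2.trans_le hs.2⟩

/-- The measures `v_{*u} ds` and `v dμ` have the same image under `u_*` and `u`. -/
theorem map_decRearr_relRearr (hu : Measurable u) (hub : ∀ x, u x ∈ Set.Icc 0 U)
    (hv : Measurable v) (hvb : ∀ x, v x ∈ Set.Icc 0 C) :
    ((volume.restrict (Set.Ioo 0 (μ.real Set.univ))).withDensity
      fun s => ENNReal.ofReal (relRearr μ u v s)).map (decRearr μ u) =
    (μ.withDensity fun y => ENNReal.ofReal (v y)).map u := by
  have hum : AEMeasurable (decRearr μ u) ((volume.restrict (Set.Ioo 0 (μ.real Set.univ))).withDensity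
      fun s => ENNReal.ofReal (relRearr μ u v s)) :=
    (aemeasurable_decRearr hub).mono_ac (withDensity_absolutelyContinuous _ _)
  have hIoi : ∀ q, ((volume.restrict (Set.Ioo 0 (μ.real Set.univ))).withDensity
      fun s => ENNReal.ofReal (relRearr μ u v s)).map (decRearr μ u) (Set.Ioi q) =
    (μ.withDensity fun y => ENNReal.ofReal (v y)).map u (Set.Ioi q) := by
    intro q
    rw [Measure.map_apply_of_aemeasurable hum measurableSet_Ioi,
      Measure.map_apply hu measurableSet_Ioi, withDensity_apply' _ _, withDensity_apply' _ _,
      Measure.restrict_restrict' measurableSet_Ioo]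
    change ∫⁻ s in {s | q < decRearr μ u s} ∩ _, _ = ∫⁻ y in {y | q < u y}, _ ∂μ
    rw [Ioo_inter_lt_decRearr hub, lintegral_relRearr hu hub hv hvb]
  have huniv := lintegral_relRearr (μ := μ) hu hub hv hvb (-1)
  have hset : {y | -1 < u y} = Set.univ := by
    ext y; simpa using (neg_one_lt_zero).trans_le (hub y).1
  rw [distributionFn_eq_univ hub neg_one_lt_zero, hset, Measure.restrict_univ] at huniv
  have : IsFiniteMeasure ((μ.withDensity fun y => ENNReal.ofReal (v y)).map u) := by
    have := isFiniteMeasure_withDensity_ofReal (integrable_of_mem_Icc (μ := μ) hv hvb).2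
    infer_instance
  refine (ext_of_Ioi_of_univ ?_ fun q => (hIoi q).symm).symm
  rw [Measure.map_apply_of_aemeasurable hum MeasurableSet.univ,
    Measure.map_apply hu MeasurableSet.univ]
  simp only [Set.preimage_univ, withDensity_apply _ MeasurableSet.univ, Measure.restrict_univ]
  exact huniv.symm

/-- Integrating a function of `u_*` against the relative rearrangement `v_{*u}` amounts to
integrating the same function of `u` against `v`. -/
theorem integral_mul_relRearr (hu : Measurable u) (hub : ∀ x, u x ∈ Set.Icc 0 U)
    (hv : Measurable v) (hvb : ∀ x, v x ∈ Set.Icc 0 C) {g : ℝ → ℝ} (hg : Measurable g) :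
    ∫ s in (0 : ℝ)..μ.real Set.univ, g (decRearr μ u s) * relRearr μ u v s =
      ∫ y, g (u y) * v y ∂μ := by
  have hum : AEMeasurable (decRearr μ u) ((volume.restrict (Set.Ioo 0 (μ.real Set.univ))).withDensity
      fun s => ENNReal.ofReal (relRearr μ u v s)) :=
    (aemeasurable_decRearr hub).mono_ac (withDensity_absolutelyContinuous _ _)
  have h1 := integral_map hum (f := g) hg.aestronglyMeasurable
  have h2 := integral_map (μ := μ.withDensity fun y => ENNReal.ofReal (v y)) hu.aemeasurable
    (f := g) hg.aestronglyMeasurable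
  rw [map_decRearr_relRearr hu hub hv hvb, h2] at h1
  have hm : Measurable (relRearr μ u v) := measurable_deriv _
  rw [integral_withDensity_eq_integral_toReal_smul hv.ennreal_ofReal (by simp),
    integral_withDensity_eq_integral_toReal_smul hm.ennreal_ofReal (by simp)] at h1
  rw [intervalIntegral.integral_of_le measureReal_nonneg, integral_Ioc_eq_integral_Ioo]
  calc _ = _ := setIntegral_congr_fun measurableSet_Ioo fun s hs => ?_
    _ = _ := h1.symm
    _ = _ := integral_congr_ae (ae_of_all _ fun y => ?_)
  · simp only [smul_eq_mul, ENNReal.toReal_ofReal (relRearr_nonneg hu hub hv hvb hs), mul_comm]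
  · simp only [smul_eq_mul, ENNReal.toReal_ofReal (hvb y).1, mul_comm]

end RelativeRearrangement

/-! ### Rearranged filters as nonlocal filters -/

section Filters

variable {α : Type*} [MeasurableSpace α] {μ : Measure α} {u u' v v' : α → ℝ}

theorem decRearr_congr (h : u =ᵐ[μ] u') : decRearr μ u = decRearr μ u' := by
  have hm : distributionFn μ u = distributionFn μ u' := by
    funext q
    refine measureReal_congr ?_
    filter_upwards [h] with x hx
    simp only [Set.ofPred, hx]
  funext s
  simp only [decRearr, essSup_congr_ae h, essInf_congr_ae h, hm]

theorem relRearr_congr (hu : u =ᵐ[μ] u') (hv : v =ᵐ[μ] v') : relRearr μ u v = relRearr μ u' v' := by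
  have hP : relRearrPrimitive μ u v = relRearrPrimitive μ u' v' := by
    funext s
    have hset : ∀ q, ({y | q < u y} : Set α) =ᵐ[μ] {y | q < u' y} := fun q =>
      hu.mono fun x hx => by simp only [Set.ofPred, hx]
    have hset' : ∀ q, ({y | u y = q} : Set α) =ᵐ[μ] {y | u' y = q} := fun q =>
      hu.mono fun x hx => by simp only [Set.ofPred, hx]
    simp only [relRearrPrimitive, decRearr_congr hu, setIntegral_congr_set (hset _),
      measureReal_congr (hset _), Measure.restrict_congr_set (hset' _)]
    rw [integral_congr_ae (ae_restrict_of_ae hv), decRearr_congr (ae_restrict_of_ae hv)]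
  funext s
  rw [relRearr, relRearr, hP]

/-- The unrearranged nonlocal integral `∫ Φ(u(x), u(y)) w(x, y) dy`. -/
noncomputable def nonlocalIntegral (μ : Measure α) (Φ : ℝ → ℝ → ℝ) (u : α → ℝ)
    (w : α → α → ℝ) (x : α) : ℝ :=
  ∫ y, Φ (u x) (u y) * w x y ∂μ

variable [IsFiniteMeasure μ] {U C : ℝ} {w w' : α → α → ℝ} {K : ℝ → ℝ} {h : ℝ}

theorem rearrFilterDen_eq (hK : Continuous K) (hu : Measurable u') (hub : ∀ x, u' x ∈ Set.Icc 0 U)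
    (huu : u =ᵐ[μ] u') {x : α} (hx : u x = u' x) (hw : Measurable (w' x))
    (hwb : ∀ y, w' x y ∈ Set.Icc 0 C) (hww : w x =ᵐ[μ] w' x) :
    rearrFilterDen μ K h u w x = nonlocalIntegral μ (fun a b => K ((a - b) / h)) u' w' x := by
  rw [rearrFilterDen, decRearr_congr huu, relRearr_congr huu hww, hx]
  exact integral_mul_relRearr hu hub hw hwb (g := fun b => K ((u' x - b) / h))
    (by fun_prop)

theorem rearrFilterNum_eq (hK : Continuous K) (hu : Measurable u') (hub : ∀ x, u' x ∈ Set.Icc 0 U)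
    (huu : u =ᵐ[μ] u') {x : α} (hx : u x = u' x) (hw : Measurable (w' x))
    (hwb : ∀ y, w' x y ∈ Set.Icc 0 C) (hww : w x =ᵐ[μ] w' x) :
    rearrFilterNum μ K h u w x = nonlocalIntegral μ (fun a b => K ((a - b) / h) * b) u' w' x := by
  rw [rearrFilterNum, decRearr_congr huu, relRearr_congr huu hww, hx]
  exact integral_mul_relRearr hu hub hw hwb (g := fun b => K ((u' x - b) / h) * b)
    (by fun_prop)

/-- The nonlocal (not rearranged) filter, a quotient of nonlocal integrals. -/
noncomputable def nonlocalFilter (μ : Measure α) (K : ℝ → ℝ) (h : ℝ) (u : α → ℝ)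
    (w : α → α → ℝ) (x : α) : ℝ :=
  nonlocalIntegral μ (fun a b => K ((a - b) / h) * b) u w x /
    nonlocalIntegral μ (fun a b => K ((a - b) / h)) u w x

theorem rearrFilter_eq (hK : Continuous K) (hu : Measurable u') (hub : ∀ x, u' x ∈ Set.Icc 0 U)
    (huu : u =ᵐ[μ] u') {x : α} (hx : u x = u' x) (hw : Measurable (w' x))
    (hwb : ∀ y, w' x y ∈ Set.Icc 0 C) (hww : w x =ᵐ[μ] w' x) :
    rearrFilter μ K h u w x = nonlocalFilter μ K h u' w' x := by
  rw [rearrFilter, nonlocalFilter, rearrFilterDen_eq hK hu hub huu hx hw hwb hww,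
    rearrFilterNum_eq hK hu hub huu hx hw hwb hww]

variable {Φ : ℝ → ℝ → ℝ}

theorem measurable_nonlocalIntegral (hΦ : Continuous fun p : ℝ × ℝ => Φ p.1 p.2)
    (hu : Measurable u) (hw : Measurable fun z : α × α => w z.1 z.2) :
    Measurable (nonlocalIntegral μ Φ u w) := by
  have : Measurable fun z : α × α => Φ (u z.1) (u z.2) * w z.1 z.2 :=
    (hΦ.measurable.comp ((hu.comp measurable_fst).prodMk (hu.comp measurable_snd))).mul hw
  exact this.stronglyMeasurable.integral_prod_right'.measurable

theorem integrable_kernel_mul (hΦ : Continuous fun p : ℝ × ℝ => Φ p.1 p.2) {a : ℝ}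
    (ha : a ∈ Set.Icc 0 U) (hu : Measurable u) (hub : ∀ x, u x ∈ Set.Icc 0 U)
    (hv : Measurable v) (hvb : ∀ x, v x ∈ Set.Icc 0 C) :
    Integrable (fun y => Φ a (u y) * v y) μ := by
  obtain ⟨B, hB⟩ := ((isCompact_Icc (a := (0 : ℝ)) (b := U)).prod
    (isCompact_Icc (a := (0 : ℝ)) (b := U))).exists_bound_of_continuousOn hΦ.continuousOn
  refine (integrable_of_mem_Icc hv hvb).bdd_mul (c := B) ?_ (ae_of_all _ fun y => ?_)
  · exact (hΦ.measurable.comp (measurable_const.prodMk hu)).aestronglyMeasurable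
  · exact hB (a, u y) ⟨ha, hub y⟩

theorem nonlocalFilter_mem_Icc (hK : Continuous K) (hK0 : ∀ ξ, 0 ≤ K ξ) (hU : 0 ≤ U)
    (hu : Measurable u)
    (hub : ∀ x, u x ∈ Set.Icc 0 U) {x : α} (hw : Measurable (w x))
    (hwb : ∀ y, w x y ∈ Set.Icc 0 C) : nonlocalFilter μ K h u w x ∈ Set.Icc 0 U := by
  have hD : 0 ≤ nonlocalIntegral μ (fun a b => K ((a - b) / h)) u w x :=
    integral_nonneg fun y => mul_nonneg (hK0 _) (hwb y).1
  have hN : 0 ≤ nonlocalIntegral μ (fun a b => K ((a - b) / h) * b) u w x :=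
    integral_nonneg fun y => mul_nonneg (mul_nonneg (hK0 _) (hub y).1) (hwb y).1
  refine ⟨div_nonneg hN hD, div_le_of_le_mul₀ hD hU ?_⟩
  rw [nonlocalIntegral, nonlocalIntegral, ← integral_const_mul]
  refine integral_mono ?_ ?_ fun y => ?_
  · exact integrable_kernel_mul (Φ := fun a b => K ((a - b) / h) * b) (by fun_prop) (hub x) hu hub
      hw hwb
  · exact (integrable_kernel_mul (Φ := fun a b => K ((a - b) / h)) (by fun_prop) (hub x) hu hub
      hw hwb).const_mul U
  · have : 0 ≤ K ((u x - u y) / h) * w x y := mul_nonneg (hK0 _) (hwb y).1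
    nlinarith [mul_le_mul_of_nonneg_left (hub y).2 this]

theorem memLp_nonlocalFilter (hK : Continuous K) (hK0 : ∀ ξ, 0 ≤ K ξ) (hU : 0 ≤ U)
    (hu : Measurable u)
    (hub : ∀ x, u x ∈ Set.Icc 0 U) (hw : Measurable fun z : α × α => w z.1 z.2)
    (hwb : ∀ x y, w x y ∈ Set.Icc 0 C) : MemLp (nonlocalFilter μ K h u w) ∞ μ := by
  refine memLp_top_of_bound ?_ U (ae_of_all _ fun x => ?_)
  · exact ((measurable_nonlocalIntegral (by fun_prop) hu hw).div
      (measurable_nonlocalIntegral (by fun_prop) hu hw)).aestronglyMeasurable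
  · have := nonlocalFilter_mem_Icc (μ := μ) (h := h) hK hK0 hU hu hub (x := x)
      hw.of_uncurry_left (hwb x)
    rw [Real.norm_eq_abs, abs_of_nonneg this.1]
    exact this.2

end Filters

/-! ### Step function approximations -/

section StepFunctions

/-- A bounded measurable function is approximated from below by step functions, with uniform
error `1 / (n + 1)`. -/
theorem exists_simpleFunc_le {α : Type*} [MeasurableSpace α] {f : α → ℝ} {C : ℝ}
    (hf : Measurable f) (hb : ∀ x, f x ∈ Set.Icc 0 C) (n : ℕ) :
    ∃ g : SimpleFunc α ℝ, ∀ x, 0 ≤ g x ∧ g x ≤ f x ∧ f x ≤ g x + 1 / ((n : ℝ) + 1) := by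
  have hn : (0 : ℝ) < (n : ℝ) + 1 := by positivity
  let F : α → ℕ := fun x => ⌊((n : ℝ) + 1) * f x⌋₊
  have hF : Measurable F := (measurable_const.mul hf).nat_floor
  have hrange : (Set.range fun x => (F x : ℝ) / ((n : ℝ) + 1)).Finite := by
    refine ((Set.finite_Iic ⌊((n : ℝ) + 1) * C⌋₊).image
      fun k : ℕ => (k : ℝ) / ((n : ℝ) + 1)).subset ?_
    rintro _ ⟨x, rfl⟩
    exact ⟨F x, Nat.floor_le_floor (mul_le_mul_of_nonneg_left (hb x).2 hn.le), rfl⟩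
  have hmeas : Measurable fun x => (F x : ℝ) / ((n : ℝ) + 1) :=
    (measurable_from_top.comp hF).div_const _
  refine ⟨⟨_, fun a => hmeas (measurableSet_singleton a), hrange⟩, fun x => ?_⟩
  change 0 ≤ (F x : ℝ) / ((n : ℝ) + 1) ∧ (F x : ℝ) / ((n : ℝ) + 1) ≤ f x ∧
    f x ≤ (F x : ℝ) / ((n : ℝ) + 1) + 1 / ((n : ℝ) + 1)
  have h1 : (F x : ℝ) ≤ ((n : ℝ) + 1) * f x := Nat.floor_le (mul_nonneg hn.le (hb x).1)
  have h2 : ((n : ℝ) + 1) * f x < F x + 1 := Nat.lt_floor_add_one _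
  refine ⟨by positivity, ?_, ?_⟩
  · rw [div_le_iff₀ hn]; linarith
  · rw [← add_div, le_div_iff₀ hn]; linarith

variable {E : Type*} [NormedAddCommGroup E] [MeasurableSpace E] [BorelSpace E]

/-- A finite measure with bounded support that does not charge spheres has balls of every
admissible mass. The radius can be chosen monotone, hence measurable, in the mass: a right inverse
of a monotone function is monotone. -/
theorem exists_monotone_radius (ν : Measure E) [IsFiniteMeasure ν]
    (hsphere : ∀ r, ν (Metric.sphere 0 r) = 0) {R : ℝ} (hR0 : 0 ≤ R) (hR : ∀ᵐ y ∂ν, ‖y‖ ≤ R) :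
    ∃ τ : ℝ → ℝ, Monotone τ ∧ ∀ r ∈ Set.Icc 0 (ν.real Set.univ), ν.real {y | ‖y‖ ≤ τ r} = r := by
  -- The lower end `-1` lies below all norms, so that balls are compared with intervals `(-1, t]`.
  let F : ℝ → ℝ := fun t => ν.real {y | ‖y‖ ≤ t}
  have hFmono : Monotone F := fun s t hst =>
    measureReal_mono fun y (hy : ‖y‖ ≤ s) => hy.trans hst
  have : NullSingletonClass (ν.map norm) := by
    refine ⟨fun r => ?_⟩
    rw [Measure.map_apply measurable_norm (measurableSet_singleton r), ← hsphere r]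
    congr 1; ext y; simp
  have hF : ∀ t ∈ Set.Icc (-1) R, F t = ∫ _ in (-1 : ℝ)..t, (1 : ℝ) ∂(ν.map norm) := by
    intro t ht
    rw [intervalIntegral.integral_of_le ht.1, setIntegral_const, smul_eq_mul, mul_one,
      measureReal_def, Measure.map_apply measurable_norm measurableSet_Ioc]
    change (ν {y | ‖y‖ ≤ t}).toReal = _
    congr 2; ext y
    have : -1 < ‖y‖ := by linarith [norm_nonneg y]
    simp [this]
  have hcont : ContinuousOn F (Set.Icc (-1) R) := by
    refine ContinuousOn.congr (Continuous.continuousOn ?_) hF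
    exact intervalIntegral.continuous_primitive (fun _ _ => intervalIntegrable_const) _
  have hF0 : F (-1) = 0 := by
    have : {y : E | ‖y‖ ≤ -1} = ∅ := by
      ext y
      have : -1 < ‖y‖ := by linarith [norm_nonneg y]
      simpa using this
    simp [F, this]
  have hFR : F R = ν.real Set.univ := measureReal_congr (eventuallyEq_univ.2 hR)
  have hivt := intermediate_value_Icc (by linarith : (-1 : ℝ) ≤ R) hcont
  rw [hF0, hFR] at hivt
  choose! τ hτ using fun r (hr : r ∈ Set.Icc 0 (ν.real Set.univ)) => hivt hr
  have hmono : MonotoneOn τ (Set.Icc 0 (ν.real Set.univ)) := by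
    intro r hr r' hr' h
    by_contra! hlt
    have := hFmono hlt.le
    rw [(hτ r hr).2, (hτ r' hr').2] at this
    exact hlt.ne (by rw [le_antisymm h this])
  have h0 : (0 : ℝ) ≤ ν.real Set.univ := measureReal_nonneg
  refine ⟨Set.IccExtend h0 fun r => τ r, ?_, fun r hr => ?_⟩
  · exact Monotone.IccExtend _ fun r r' h => hmono r.2 r'.2 h
  · rw [Set.IccExtend_of_mem _ _ hr]
    exact (hτ r hr).2

/-- Dithering: a weight `w` with values in `[0, C]` is uniformly approximated by step functions
that have, for every `x`, exactly the same `y`-integrals as `w(x, ·)` over each level set of a given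
step function `g`. The weight is rounded down to a multiple of `1 / (m + 1)`, and the missing mass
is restored by adding `1 / (m + 1)` on a set whose slices meet the level sets of `g` in balls of
suitable radius. -/
theorem exists_simpleFunc_weight (μ : Measure E) [IsFiniteMeasure μ]
    (hsphere : ∀ r, μ (Metric.sphere 0 r) = 0) {R : ℝ} (hR0 : 0 ≤ R) (hR : ∀ᵐ y ∂μ, ‖y‖ ≤ R)
    {w : E → E → ℝ} {C : ℝ} (hw : Measurable fun z : E × E => w z.1 z.2)
    (hwb : ∀ x y, w x y ∈ Set.Icc 0 C) (g : SimpleFunc E ℝ) (m : ℕ) :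
    ∃ ω : SimpleFunc (E × E) ℝ, (∀ z, 0 ≤ ω z) ∧
      (∀ z, |ω z - w z.1 z.2| ≤ 1 / ((m : ℝ) + 1)) ∧
      ∀ x a, ∫ y in g ⁻¹' {a}, ω (x, y) ∂μ = ∫ y in g ⁻¹' {a}, w x y ∂μ := by
  have hm : (0 : ℝ) < 1 / ((m : ℝ) + 1) := by positivity
  set δ : ℝ := 1 / ((m : ℝ) + 1) with hδ
  obtain ⟨q, hq⟩ := exists_simpleFunc_le hw (fun z => hwb z.1 z.2) m
  let ρ : E × E → ℝ := fun z => δ⁻¹ * (w z.1 z.2 - q z)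
  have hρ : Measurable ρ := measurable_const.mul (hw.sub q.measurable)
  have hρb : ∀ z, ρ z ∈ Set.Icc 0 1 := by
    intro z
    have h := hq z
    refine ⟨mul_nonneg (by positivity) (by linarith), ?_⟩
    rw [inv_mul_le_iff₀ hm]; linarith
  let r : ℝ → E → ℝ := fun a x => ∫ y in g ⁻¹' {a}, ρ (x, y) ∂μ
  have hr : ∀ a, Measurable (r a) := fun a =>
    hρ.stronglyMeasurable.integral_prod_right'.measurable
  have hA : ∀ a, MeasurableSet (g ⁻¹' {a}) := fun a => g.measurableSet_preimage _
  have hrb : ∀ a x, r a x ∈ Set.Icc 0 (μ.real (g ⁻¹' {a})) := by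
    intro a x
    have := setIntegral_mem_Icc (μ := μ) (hρ.comp measurable_prodMk_left) (fun y => hρb (x, y))
      (hA a)
    rwa [one_mul] at this
  choose τ hτm hτ using fun a => exists_monotone_radius (μ.restrict (g ⁻¹' {a}))
    (fun r => Measure.absolutelyContinuous_of_le Measure.restrict_le_self (hsphere r)) hR0
    (ae_restrict_of_ae hR)
  let S : Set (E × E) := ⋃ a ∈ g.range, {z | g z.2 = a} ∩ {z | ‖z.2‖ ≤ τ a (r a z.1)}
  have hS : MeasurableSet S := by
    refine Finset.measurableSet_biUnion _ fun a _ => MeasurableSet.inter ?_ ?_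
    · exact measurable_snd (hA a)
    · exact measurableSet_le measurable_snd.norm
        ((hτm a).measurable.comp ((hr a).comp measurable_fst))
  have hSmem : ∀ x y, (x, y) ∈ S ↔ ‖y‖ ≤ τ (g y) (r (g y) x) := by
    intro x y
    simp only [S, Set.mem_iUnion, Set.mem_inter_iff, Set.mem_ofPred_eq]
    constructor
    · rintro ⟨a, -, rfl, h⟩; exact h
    · intro h; exact ⟨g y, SimpleFunc.mem_range_self g y, rfl, h⟩
  let ω : SimpleFunc (E × E) ℝ :=
    q + SimpleFunc.piecewise S hS (SimpleFunc.const _ δ) (SimpleFunc.const _ 0)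
  have hω : ∀ z, ω z = q z + S.indicator (fun _ => δ) z := by
    intro z
    simp only [ω, SimpleFunc.coe_add, Pi.add_apply, SimpleFunc.coe_piecewise, SimpleFunc.coe_const]
    by_cases hz : z ∈ S <;> simp [hz]
  refine ⟨ω, fun z => ?_, fun z => ?_, fun x a => ?_⟩
  · rw [hω]
    exact add_nonneg (hq z).1 (Set.indicator_nonneg (fun _ _ => hm.le) z)
  · rw [hω]
    have h := hq z
    by_cases hz : z ∈ S
    · rw [Set.indicator_of_mem hz, abs_le]; constructor <;> linarith
    · rw [Set.indicator_of_notMem hz, abs_le]; constructor <;> linarith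
  · have hqi : IntegrableOn (fun y => q (x, y)) (g ⁻¹' {a}) μ :=
      (integrable_of_mem_Icc (C := C) (q.measurable.comp measurable_prodMk_left)
        fun y => ⟨(hq (x, y)).1, (hq (x, y)).2.1.trans (hwb x y).2⟩).integrableOn
    have hSx : MeasurableSet (Prod.mk x ⁻¹' S) := measurable_prodMk_left hS
    have hind : ∫ y in g ⁻¹' {a}, S.indicator (fun _ => δ) (x, y) ∂μ = δ * r a x := by
      have : (fun y => S.indicator (fun _ => δ) (x, y)) =
          (Prod.mk x ⁻¹' S).indicator fun _ => δ := rfl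
      rw [this, integral_indicator hSx, setIntegral_const, smul_eq_mul, mul_comm]
      congr 1
      rw [measureReal_restrict_apply hSx, ← hτ a (r a x)
        ⟨(hrb a x).1, by rw [measureReal_restrict_apply_univ]; exact (hrb a x).2⟩,
        measureReal_restrict_apply (measurableSet_le measurable_norm measurable_const)]
      congr 1; ext y
      simp only [Set.mem_inter_iff, Set.mem_preimage, hSmem, Set.mem_singleton_iff,
        Set.mem_ofPred_eq]
      constructor
      · rintro ⟨h, rfl⟩; exact ⟨h, rfl⟩
      · rintro ⟨h, rfl⟩; exact ⟨h, rfl⟩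
    have hri : δ * r a x = ∫ y in g ⁻¹' {a}, (w x y - q (x, y)) ∂μ := by
      rw [← integral_const_mul]
      refine integral_congr_ae (ae_of_all _ fun y => ?_)
      simp only [ρ]; rw [mul_inv_cancel_left₀ hm.ne']
    have hwi : IntegrableOn (fun y => w x y) (g ⁻¹' {a}) μ :=
      (integrable_of_mem_Icc hw.of_uncurry_left (hwb x)).integrableOn
    simp only [hω]
    rw [integral_add hqi, hind, hri, integral_sub hwi hqi]
    · ring
    · exact (integrable_const δ).indicator hSx

/-- Densities with equal integrals over the level sets of a step function `g` cannot be told apart by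
functions of `g`. -/
theorem integral_simpleFunc_mul_congr {α : Type*} [MeasurableSpace α] {μ : Measure α}
    [IsFiniteMeasure μ] {v v' : α → ℝ} (hv : Integrable v μ) (hv' : Integrable v' μ)
    (g : SimpleFunc α ℝ) (h : ∀ a, ∫ y in g ⁻¹' {a}, v y ∂μ = ∫ y in g ⁻¹' {a}, v' y ∂μ)
    (φ : ℝ → ℝ) : ∫ y, φ (g y) * v y ∂μ = ∫ y, φ (g y) * v' y ∂μ := by
  have hA : ∀ a, MeasurableSet (g ⁻¹' {a}) := fun a => g.measurableSet_preimage _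
  have key : ∀ v : α → ℝ, Integrable v μ →
      ∫ y, φ (g y) * v y ∂μ = ∑ a ∈ g.range, φ a * ∫ y in g ⁻¹' {a}, v y ∂μ := by
    intro v hv
    have hU : ⋃ a ∈ g.range, g ⁻¹' {a} = Set.univ := by
      ext y; simp
    have hc : ∀ a, Set.EqOn (fun y => φ (g y) * v y) (fun y => φ a * v y) (g ⁻¹' {a}) := by
      intro a y hy
      simp only [Set.mem_preimage, Set.mem_singleton_iff] at hy
      simp only [hy]
    rw [← setIntegral_univ, ← hU, integral_biUnion_finset _ fun a _ => hA a]
    · refine Finset.sum_congr rfl fun a _ => ?_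
      rw [setIntegral_congr_fun (hA a) (hc a), integral_const_mul]
    · intro a _ b _ hab
      exact (Set.disjoint_singleton.2 hab).preimage g
    · intro a _
      exact (integrableOn_congr_fun (hc a) (hA a)).2 (hv.integrableOn.const_mul (φ a))
  rw [key v hv, key v' hv']
  simp only [h]

end StepFunctions

/-! ### Uniform convergence of the filters -/

section Convergence

variable {α : Type*} [MeasurableSpace α] {μ : Measure α}

theorem abs_integral_mul_sub_le {φ ψ ω : α → ℝ} {η : ℝ} (hφ : Integrable (fun y => φ y * ω y) μ)
    (hψ : Integrable (fun y => ψ y * ω y) μ) (hω : Integrable ω μ) (hω0 : ∀ y, 0 ≤ ω y)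
    (h : ∀ y, |φ y - ψ y| ≤ η) :
    |∫ y, φ y * ω y ∂μ - ∫ y, ψ y * ω y ∂μ| ≤ η * ∫ y, ω y ∂μ := by
  rw [← integral_sub hφ hψ, ← integral_const_mul]
  refine (abs_integral_le_integral_abs).trans
    (integral_mono (hφ.sub hψ).abs (hω.const_mul η) fun y => ?_)
  simp only
  rw [← sub_mul, abs_mul, abs_of_nonneg (hω0 y)]
  exact mul_le_mul_of_nonneg_right (h y) (hω0 y)

theorem tendsto_eLpNorm_top_of_eventually_le {ι : Type*} [Preorder ι] {F : ι → α → ℝ} {G : α → ℝ}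
    (H : ∀ ε : ℝ, 0 < ε → ∀ᶠ i in atTop, ∀ᵐ x ∂μ, |F i x - G x| ≤ ε) :
    Tendsto (fun i => eLpNorm (fun x => F i x - G x) ∞ μ) atTop (𝓝 0) := by
  refine ENNReal.tendsto_nhds_zero.2 fun ε hε => ?_
  obtain ⟨r, hr0, hr⟩ := ENNReal.lt_iff_exists_real_btwn.1 hε
  have hr' : 0 < r := ENNReal.ofReal_pos.1 hr.1
  filter_upwards [H r hr'] with i hi
  rw [eLpNorm_exponent_top]
  exact (eLpNormEssSup_le_of_ae_bound hi).trans hr.2.le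

theorem ae_tendsto_of_eventually_le {ι : Type*} [Preorder ι] [Countable ι] [IsDirectedOrder ι]
    [Nonempty ι] {F : ι → α → ℝ} {G : α → ℝ}
    (H : ∀ ε : ℝ, 0 < ε → ∀ᶠ i in atTop, ∀ᵐ x ∂μ, |F i x - G x| ≤ ε) :
    ∀ᵐ x ∂μ, Tendsto (fun i => F i x) atTop (𝓝 (G x)) := by
  have hex : ∀ k : ℕ, ∃ N : ι, ∀ i, N ≤ i → ∀ᵐ x ∂μ, |F i x - G x| ≤ 1 / ((k : ℝ) + 1) :=
    fun k => eventually_atTop.1 (H (1 / ((k : ℝ) + 1)) (by positivity))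
  choose N hN using hex
  have h : ∀ᵐ x ∂μ, ∀ k i, N k ≤ i → |F i x - G x| ≤ 1 / ((k : ℝ) + 1) :=
    ae_all_iff.2 fun k => ae_all_iff.2 fun i => eventually_imp_distrib_left.2 (hN k i)
  filter_upwards [h] with x hx
  refine Metric.tendsto_nhds.2 fun ε hε => ?_
  obtain ⟨k, hk⟩ := exists_nat_one_div_lt hε
  filter_upwards [eventually_ge_atTop (N k)] with i hi
  rw [Real.dist_eq]
  exact (hx k i hi).trans_lt hk

variable [IsFiniteMeasure μ] {U C : ℝ} {u : α → ℝ} {w : α → α → ℝ} {un : ℕ → SimpleFunc α ℝ}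
  {wm : ℕ → SimpleFunc (α × α) ℝ}

/-- The nonlocal integrals of the approximants converge, with an error that is small relative to
the mass `∫ w(x, y) dy`. The weights `w_m` may be exchanged with `w` at no cost in integrals of
functions of `u_m`, and `u_m` differs from both `u` and `u_n` by a uniformly small amount. -/
theorem eventually_abs_nonlocalIntegral_sub_le {Φ : ℝ → ℝ → ℝ}
    (hΦ : Continuous fun p : ℝ × ℝ => Φ p.1 p.2) (hu : Measurable u)
    (hub : ∀ x, u x ∈ Set.Icc 0 U) (hw : Measurable fun z : α × α => w z.1 z.2)
    (hwb : ∀ x y, w x y ∈ Set.Icc 0 C)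
    (hun : ∀ n x, 0 ≤ un n x ∧ un n x ≤ u x ∧ u x ≤ un n x + 1 / ((n : ℝ) + 1))
    (hwm0 : ∀ m z, 0 ≤ wm m z) (hwm1 : ∀ m z, wm m z ≤ C + 1)
    (hwm : ∀ m x a, ∫ y in un m ⁻¹' {a}, wm m (x, y) ∂μ = ∫ y in un m ⁻¹' {a}, w x y ∂μ)
    {ε : ℝ} (hε : 0 < ε) :
    ∀ᶠ p : ℕ × ℕ in atTop, ∀ x, |nonlocalIntegral μ Φ (un p.1) (fun x y => wm p.2 (x, y)) x -
      nonlocalIntegral μ Φ u w x| ≤ ε * ∫ y, w x y ∂μ := by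
  have huc := ((isCompact_Icc (a := (0 : ℝ)) (b := U)).prod
    (isCompact_Icc (a := (0 : ℝ)) (b := U))).uniformContinuousOn_of_continuous hΦ.continuousOn
  obtain ⟨δ, hδ, hΦδ⟩ := Metric.uniformContinuousOn_iff.1 huc (ε / 2) (half_pos hε)
  obtain ⟨N, hN⟩ := exists_nat_one_div_lt (half_pos hδ)
  have hunb : ∀ n x, un n x ∈ Set.Icc 0 U := fun n x =>
    ⟨(hun n x).1, (hun n x).2.1.trans (hub x).2⟩
  have herr : ∀ n, N ≤ n → ∀ x, |un n x - u x| < δ / 2 := by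
    intro n hn x
    have h1 : 1 / ((n : ℝ) + 1) ≤ 1 / ((N : ℝ) + 1) := Nat.one_div_le_one_div hn
    have h2 := hun n x
    rw [abs_sub_comm, abs_of_nonneg (by linarith)]
    linarith
  have hmod : ∀ {a b a' b' : ℝ}, a ∈ Set.Icc 0 U → b ∈ Set.Icc 0 U → a' ∈ Set.Icc 0 U →
      b' ∈ Set.Icc 0 U → |a - a'| < δ → |b - b'| < δ → |Φ a b - Φ a' b'| ≤ ε / 2 := by
    intro a b a' b' ha hb ha' hb' h1 h2
    have := hΦδ (a, b) ⟨ha, hb⟩ (a', b') ⟨ha', hb'⟩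
      (by rw [Prod.dist_eq]; exact max_lt h1 h2)
    exact this.le
  refine eventually_atTop.2 ⟨(N, N), fun p hp x => ?_⟩
  obtain ⟨n, m⟩ := p
  have hn : N ≤ n := hp.1
  have hm : N ≤ m := hp.2
  have hwmx : Measurable fun y => wm m (x, y) := (wm m).measurable.comp measurable_prodMk_left
  have hwmb : ∀ y, wm m (x, y) ∈ Set.Icc 0 (C + 1) := fun y => ⟨hwm0 m _, hwm1 m _⟩
  have hwx : Measurable (w x) := hw.of_uncurry_left
  have hwmi : Integrable (fun y => wm m (x, y)) μ := integrable_of_mem_Icc hwmx hwmb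
  have hwi : Integrable (w x) μ := integrable_of_mem_Icc hwx (hwb x)
  have hswap := integral_simpleFunc_mul_congr hwmi hwi (un m) (hwm m x)
  have hmass : ∫ y, wm m (x, y) ∂μ = ∫ y, w x y ∂μ := by
    simpa using hswap fun _ => 1
  have h1 := abs_integral_mul_sub_le (η := ε / 2)
    (integrable_kernel_mul hΦ (hunb n x) (un n).measurable (hunb n) hwmx hwmb)
    (integrable_kernel_mul (μ := μ) hΦ (hub x) (un m).measurable (hunb m) hwmx hwmb)
    hwmi (fun y => hwm0 m (x, y)) fun y => by
      refine hmod (hunb n x) (hunb n y) (hub x) (hunb m y) ?_ ?_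
      · linarith [herr n hn x]
      · have ha := abs_lt.1 (herr n hn y)
        have hb := abs_lt.1 (herr m hm y)
        exact abs_lt.2 ⟨by linarith, by linarith⟩
  have h2 := abs_integral_mul_sub_le (η := ε / 2)
    (integrable_kernel_mul (μ := μ) hΦ (hub x) (un m).measurable (hunb m) hwx (hwb x))
    (integrable_kernel_mul hΦ (hub x) hu hub hwx (hwb x))
    hwi (fun y => (hwb x y).1) fun y => by
      refine hmod (hub x) (hunb m y) (hub x) (hub y) (by simpa using hδ) ?_
      linarith [herr m hm y]
  rw [hmass, hswap (Φ (u x))] at h1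
  have := abs_sub_le (∫ y, Φ (un n x) (un n y) * wm m (x, y) ∂μ)
    (∫ y, Φ (u x) (un m y) * w x y ∂μ) (∫ y, Φ (u x) (u y) * w x y ∂μ)
  simp only [nonlocalIntegral]
  linarith

/-- Stability of a quotient `N / D ∈ [0, U]` under perturbations that are small relative to a
quantity `W ≤ D / c`. If `W = 0`, both quotients coincide, whether or not they are genuine. -/
theorem abs_div_sub_div_le {N D N' D' W U c ε : ℝ} (hc : 0 < c) (hW : 0 ≤ W) (hD : c * W ≤ D)
    (hq : N / D ∈ Set.Icc 0 U) (hε0 : 0 ≤ ε) (hε : ε ≤ c / 2) (hN' : |N' - N| ≤ ε * W)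
    (hD' : |D' - D| ≤ ε * W) :
    |N' / D' - N / D| ≤ ε * (2 * (1 + U) / c) := by
  have hU : 0 ≤ U := hq.1.trans hq.2
  rcases hW.eq_or_lt with rfl | hW
  · rw [mul_zero, abs_nonpos_iff, sub_eq_zero] at hN' hD'
    rw [hN', hD', sub_self, abs_zero]
    positivity
  · have hD0 : 0 < D := (mul_pos hc hW).trans_le hD
    have hεW : ε * W ≤ c / 2 * W := mul_le_mul_of_nonneg_right hε hW.le
    have hD'0 : c / 2 * W ≤ D' := by linarith [(abs_le.1 hD').1]
    have hD'pos : 0 < D' := (by positivity : 0 < c / 2 * W).trans_le hD'0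
    have he : N' / D' - N / D = ((N' - N) - N / D * (D' - D)) / D' := by
      field_simp; ring
    rw [he, abs_div, abs_of_pos hD'pos, div_le_iff₀ hD'pos]
    calc |(N' - N) - N / D * (D' - D)| ≤ |N' - N| + |N / D * (D' - D)| := abs_sub _ _
      _ ≤ ε * W + U * (ε * W) := by
        rw [abs_mul, abs_of_nonneg hq.1]
        exact add_le_add hN' (mul_le_mul hq.2 hD' (abs_nonneg _) hU)
      _ = ε * (2 * (1 + U) / c) * (c / 2 * W) := by field_simp
      _ ≤ ε * (2 * (1 + U) / c) * D' := by gcongr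

/-- The filters of the approximants converge uniformly on the set where the normalization is
nondegenerate, and their denominators are eventually positive there. -/
theorem eventually_abs_nonlocalFilter_sub_le {K : ℝ → ℝ} {h : ℝ} (hK : Continuous K)
    (hK0 : ∀ ξ, 0 ≤ K ξ) (hU : 0 ≤ U) (hu : Measurable u)
    (hub : ∀ x, u x ∈ Set.Icc 0 U) (hw : Measurable fun z : α × α => w z.1 z.2)
    (hwb : ∀ x y, w x y ∈ Set.Icc 0 C)
    (hun : ∀ n x, 0 ≤ un n x ∧ un n x ≤ u x ∧ u x ≤ un n x + 1 / ((n : ℝ) + 1))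
    (hwm0 : ∀ m z, 0 ≤ wm m z) (hwm1 : ∀ m z, wm m z ≤ C + 1)
    (hwm : ∀ m x a, ∫ y in un m ⁻¹' {a}, wm m (x, y) ∂μ = ∫ y in un m ⁻¹' {a}, w x y ∂μ)
    {c : ℝ} (hc : 0 < c) {ε : ℝ} (hε : 0 < ε) :
    ∀ᶠ p : ℕ × ℕ in atTop, ∀ x,
      c * ∫ y, w x y ∂μ ≤ nonlocalIntegral μ (fun a b => K ((a - b) / h)) u w x →
      |nonlocalFilter μ K h (un p.1) (fun x y => wm p.2 (x, y)) x - nonlocalFilter μ K h u w x| ≤ ε ∧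
      (0 < ∫ y, w x y ∂μ → 0 < nonlocalIntegral μ (fun a b => K ((a - b) / h)) (un p.1)
        (fun x y => wm p.2 (x, y)) x) := by
  have hA : 0 < 2 * (1 + U) / c := by positivity
  set η := min (c / 2) (ε / (2 * (1 + U) / c)) with hη
  have hη0 : 0 < η := lt_min (half_pos hc) (div_pos hε hA)
  have hηε : η * (2 * (1 + U) / c) ≤ ε := by
    rw [← le_div_iff₀ hA]; exact min_le_right _ _
  filter_upwards [eventually_abs_nonlocalIntegral_sub_le (μ := μ)
      (Φ := fun a b => K ((a - b) / h) * b) (by fun_prop) hu hub hw hwb hun hwm0 hwm1 hwm hη0,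
    eventually_abs_nonlocalIntegral_sub_le (μ := μ)
      (Φ := fun a b => K ((a - b) / h)) (by fun_prop) hu hub hw hwb hun hwm0 hwm1 hwm hη0]
    with p hpN hpD x hx
  have hW : 0 ≤ ∫ y, w x y ∂μ := integral_nonneg fun y => (hwb x y).1
  refine ⟨(abs_div_sub_div_le hc hW hx ?_ hη0.le (min_le_left _ _) (hpN x) (hpD x)).trans hηε,
    fun hpos => ?_⟩
  · exact nonlocalFilter_mem_Icc hK hK0 hU hu hub hw.of_uncurry_left (hwb x)
  · have h1 := (abs_le.1 (hpD x)).1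
    have h2 := mul_le_mul_of_nonneg_right (min_le_left (c / 2) (ε / (2 * (1 + U) / c))) hW
    have h3 := mul_pos hc hpos
    rw [← hη] at h2
    linarith

/-- A nonnegative essentially bounded function has a measurable representative that satisfies the
bounds everywhere. -/
theorem exists_measurable_mem_Icc_ae_eq {β : Type*} [MeasurableSpace β] {ν : Measure β} {f : β → ℝ}
    (hf : MemLp f ∞ ν) (hf0 : ∀ᵐ x ∂ν, 0 ≤ f x) :
    ∃ (f' : β → ℝ) (C : ℝ), 0 ≤ C ∧ Measurable f' ∧ (∀ x, f' x ∈ Set.Icc 0 C) ∧ f =ᵐ[ν] f' := by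
  let C := (eLpNorm f ∞ ν).toReal
  have hC : 0 ≤ C := ENNReal.toReal_nonneg
  refine ⟨fun x => min C (max 0 (hf.1.mk f x)), C, hC, ?_, fun x => ?_, ?_⟩
  · exact measurable_const.min (measurable_const.max hf.1.measurable_mk)
  · exact ⟨le_min hC (le_max_left _ _), min_le_left _ _⟩
  · have hb : ∀ᵐ x ∂ν, ‖f x‖ₑ ≤ eLpNorm f ∞ ν := by
      rw [eLpNorm_exponent_top]; exact ae_le_eLpNormEssSup
    filter_upwards [hf.1.ae_eq_mk, hf0, hb] with x h1 h2 h3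
    have h4 : f x ≤ C := by
      have := ENNReal.toReal_mono hf.2.ne h3
      rw [toReal_enorm] at this
      exact (le_abs_self _).trans this
    rw [← h1, max_eq_right h2, min_eq_right h4]

end Convergence

/-! ### Convergence of the rearranged filters -/

theorem theorem2 (d : ℕ) (hd : 1 ≤ d)
    (Ω : Set (EuclideanSpace ℝ (Fin d))) (hΩ : IsOpen Ω) (hΩb : Bornology.IsBounded Ω)
    (μ : Measure (EuclideanSpace ℝ (Fin d))) (hμ : μ = volume.restrict Ω)
    (u : EuclideanSpace ℝ (Fin d) → ℝ)
    (hu : MemLp u ∞ μ) (hu0 : ∀ᵐ x ∂μ, 0 ≤ u x) (huflat : FinitelyManyFlatRegions μ u)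
    (w : EuclideanSpace ℝ (Fin d) → EuclideanSpace ℝ (Fin d) → ℝ)
    (hw : MemLp (fun z : EuclideanSpace ℝ (Fin d) × EuclideanSpace ℝ (Fin d) => w z.1 z.2)
      ∞ (μ.prod μ))
    (hw0 : ∀ᵐ z ∂(μ.prod μ), 0 ≤ w z.1 z.2) :
    -- step functions: measurable, with finitely many values
    ∃ (un : ℕ → SimpleFunc (EuclideanSpace ℝ (Fin d)) ℝ)
      (wm : ℕ → SimpleFunc (EuclideanSpace ℝ (Fin d) × EuclideanSpace ℝ (Fin d)) ℝ),
      (∀ n x, 0 ≤ un n x) ∧ (∀ m z, 0 ≤ wm m z) ∧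
      Tendsto (fun n => eLpNorm (fun x => un n x - u x) ∞ μ) atTop (𝓝 0) ∧
      Tendsto (fun m => eLpNorm (fun z => wm m z - w z.1 z.2) ∞ (μ.prod μ)) atTop (𝓝 0) ∧
      ∀ (K : ℝ → ℝ) (h : ℝ), Continuous K → (∀ ξ, 0 ≤ K ξ) → 0 < h →
        -- nondegenerate normalization; automatic if `K` is positive
        (∃ c : ℝ, 0 < c ∧ ∀ᵐ x ∂μ, c * ∫ y, w x y ∂μ ≤ filterNorm μ K h u w x) →
        -- the filters are bounded functions
        MemLp (rearrFilter μ K h u w) ∞ μ ∧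
        (∀ n m, MemLp (rearrFilter μ K h (un n) (fun x y => wm m (x, y))) ∞ μ) ∧
        -- the quotients are genuine quotients
        (∀ᵐ x ∂μ, 0 < ∫ y, w x y ∂μ → 0 < rearrFilterDen μ K h u w x) ∧
        (∀ᶠ p : ℕ × ℕ in atTop, ∀ᵐ x ∂μ, 0 < ∫ y, w x y ∂μ →
          0 < rearrFilterDen μ K h (un p.1) (fun x y => wm p.2 (x, y)) x) ∧
        -- convergence almost everywhere and in `L^∞`
        (∀ᵐ x ∂μ, Tendsto
          (fun p : ℕ × ℕ => rearrFilter μ K h (un p.1) (fun x y => wm p.2 (x, y)) x)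
          atTop (𝓝 (rearrFilter μ K h u w x))) ∧
        Tendsto
          (fun p : ℕ × ℕ => eLpNorm (fun x =>
            rearrFilter μ K h (un p.1) (fun x y => wm p.2 (x, y)) x - rearrFilter μ K h u w x)
            ∞ μ)
          atTop (𝓝 0) := by
  have : Nontrivial (EuclideanSpace ℝ (Fin d)) := by
    have : Nonempty (Fin d) := ⟨⟨0, hd⟩⟩
    infer_instance
  have : IsFiniteMeasure μ := by
    rw [hμ]
    exact isFiniteMeasure_restrict.2 hΩb.measure_lt_top.ne
  obtain ⟨R, hR0, hR⟩ := hΩb.exists_pos_norm_le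
  have hRμ : ∀ᵐ y ∂μ, ‖y‖ ≤ R := by
    rw [hμ]
    exact (ae_restrict_iff' hΩ.measurableSet).2 (ae_of_all _ hR)
  have hsphere : ∀ r, μ (Metric.sphere 0 r) = 0 := fun r => by
    rw [hμ]
    exact Measure.absolutelyContinuous_of_le Measure.restrict_le_self
      (Measure.addHaar_sphere volume 0 r)
  obtain ⟨u', U, hU, hum, hub, huu⟩ := exists_measurable_mem_Icc_ae_eq hu hu0
  obtain ⟨w₀, C, -, hwm', hwb', hww'⟩ := exists_measurable_mem_Icc_ae_eq hw hw0
  obtain ⟨w', rfl⟩ : ∃ w' : EuclideanSpace ℝ (Fin d) → EuclideanSpace ℝ (Fin d) → ℝ,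
    w₀ = fun z => w' z.1 z.2 := ⟨fun x y => w₀ (x, y), rfl⟩
  have hwb : ∀ x y, w' x y ∈ Set.Icc 0 C := fun x y => hwb' (x, y)
  have hww : ∀ᵐ x ∂μ, w x =ᵐ[μ] w' x := Measure.ae_ae_of_ae_prod hww'
  choose un hun using exists_simpleFunc_le hum hub
  choose wm hwm0 hwm1 hwm using fun m =>
    exists_simpleFunc_weight μ hsphere hR0.le hRμ hwm' hwb (un m) m
  have hunb : ∀ n x, un n x ∈ Set.Icc 0 U := fun n x =>
    ⟨(hun n x).1, (hun n x).2.1.trans (hub x).2⟩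
  have hwmb : ∀ m z, wm m z ∈ Set.Icc 0 (C + 1) := by
    intro m z
    have h1 : 1 / ((m : ℝ) + 1) ≤ 1 := by
      rw [div_le_one (by positivity)]; linarith [(m.cast_nonneg : (0 : ℝ) ≤ m)]
    exact ⟨hwm0 m z, by linarith [(abs_le.1 (hwm1 m z)).2, (hwb z.1 z.2).2]⟩
  have hsmall : ∀ ε : ℝ, 0 < ε → ∀ᶠ n : ℕ in atTop, 1 / ((n : ℝ) + 1) ≤ ε := fun ε hε =>
    (tendsto_one_div_add_atTop_nhds_zero_nat (𝕜 := ℝ)).eventually (ge_mem_nhds hε)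
  refine ⟨un, wm, fun n x => (hun n x).1, hwm0, ?_, ?_, ?_⟩
  · refine tendsto_eLpNorm_top_of_eventually_le fun ε hε => (hsmall ε hε).mono fun n hn => ?_
    filter_upwards [huu] with x hx
    have := hun n x
    rw [hx, abs_sub_comm, abs_of_nonneg (by linarith)]
    linarith
  · refine tendsto_eLpNorm_top_of_eventually_le fun ε hε => (hsmall ε hε).mono fun m hm => ?_
    filter_upwards [hww'] with z hz
    rw [hz]
    exact (hwm1 m z).trans hm
  rintro K h hK hK0 - ⟨c, hc, hcD⟩
  have hF : ∀ᵐ x ∂μ, rearrFilter μ K h u w x = nonlocalFilter μ K h u' w' x := by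
    filter_upwards [huu, hww] with x hx hwx
    exact rearrFilter_eq hK hum hub huu hx hwm'.of_uncurry_left (hwb x) hwx
  have hFm : ∀ n m x, rearrFilter μ K h (un n) (fun x y => wm m (x, y)) x =
      nonlocalFilter μ K h (un n) (fun x y => wm m (x, y)) x := fun n m x =>
    rearrFilter_eq hK (un n).measurable (hunb n) (ae_eq_refl _) rfl
      ((wm m).measurable.comp measurable_prodMk_left) (fun y => hwmb m (x, y)) (ae_eq_refl _)
  have hcD' : ∀ᵐ x ∂μ, c * ∫ y, w' x y ∂μ ≤
      nonlocalIntegral μ (fun a b => K ((a - b) / h)) u' w' x := by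
    filter_upwards [huu, hww, hcD] with x hx hwx hcx
    rw [integral_congr_ae hwx] at hcx
    refine hcx.trans (le_of_eq (integral_congr_ae ?_))
    filter_upwards [huu, hwx] with y hy hwy
    rw [hx, hy, hwy]
  have hconv := fun ε hε => eventually_abs_nonlocalFilter_sub_le (h := h) hK hK0 hU hum hub
    hwm' hwb hun hwm0 (fun m z => (hwmb m z).2) hwm hc (ε := ε) hε
  have hlim : ∀ ε : ℝ, 0 < ε → ∀ᶠ p : ℕ × ℕ in atTop, ∀ᵐ x ∂μ,
      |rearrFilter μ K h (un p.1) (fun x y => wm p.2 (x, y)) x - rearrFilter μ K h u w x| ≤ ε := by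
    intro ε hε
    filter_upwards [hconv ε hε] with p hp
    filter_upwards [hF, hcD'] with x hFx hcx
    rw [hFx, hFm]
    exact (hp x hcx).1
  refine ⟨?_, fun n m => ?_, ?_, ?_, ae_tendsto_of_eventually_le hlim,
    tendsto_eLpNorm_top_of_eventually_le hlim⟩
  · exact (memLp_congr_ae hF).2 (memLp_nonlocalFilter hK hK0 hU hum hub hwm' hwb)
  · refine (memLp_congr_ae (ae_of_all _ (hFm n m))).2 ?_
    exact memLp_nonlocalFilter hK hK0 hU (un n).measurable (hunb n) (wm m).measurable
      fun x y => hwmb m (x, y)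
  · filter_upwards [huu, hww, hcD'] with x hx hwx hcx hpos
    rw [rearrFilterDen_eq hK hum hub huu hx hwm'.of_uncurry_left (hwb x) hwx]
    rw [integral_congr_ae hwx] at hpos
    exact (mul_pos hc hpos).trans_le hcx
  · filter_upwards [hconv 1 one_pos] with p hp
    filter_upwards [hww, hcD'] with x hwx hcx hpos
    rw [rearrFilterDen_eq (u' := un p.1) (w' := fun x y => wm p.2 (x, y)) hK (un p.1).measurable
      (hunb p.1) (ae_eq_refl _) rfl ((wm p.2).measurable.comp measurable_prodMk_left)
      (fun y => hwmb p.2 (x, y)) (ae_eq_refl _)]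
    rw [integral_congr_ae hwx] at hpos
    exact (hp x hcx).2 hpos
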